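/- Let formulas be built from countably many variables $p_0,p_1,\dots$ with the binary connectives $\to,\&,\vee,\wedge$ and the constant $\mathtt t$. A consecution is a pair $\Gamma\rhd\varphi$ of an arbitrary set $\Gamma$ of formulas and a formula $\varphi$. A logic is the set of all consecutions $\Gamma\rhd\varphi$ such that $\varphi$ is provable from $\Gamma$ (by a proof tree without infinite branches) in a given set of axioms and rules that is closed under substitutions. Abelian logic $\mathrm{Ab}$, with $\Gamma\vdash_{\mathrm{Ab}}\varphi$ denoting its provability relation, is given by the axiom schemes $$(\varphi\to\psi)\to((\psi\to\xi)\to(\varphi\to\xi)),\quad (\varphi\to(\psi\to\xi))\to(\psi\to(\varphi\to\xi)),\quad \varphi\to\varphi,\quad ((\varphi\to\psi)\to\psi)\to\varphi,$$ $$\varphi\to\varphi\vee\psi,\quad \psi\to\varphi\vee\psi,\quad \varphi\wedge\psi\to\varphi,\quad \varphi\wedge\psi\to\psi,$$ $$(\varphi\to\chi)\wedge(\psi\to\chi)\to(\varphi\vee\psi\to\chi),\quad (\chi\to\varphi)\wedge(\chi\to\psi)\to(\chi\to\varphi\wedge\psi),$$ $$\varphi\to(\mathtt t\to\varphi),\quad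 (\mathtt t\to\varphi)\to\varphi,\quad (\varphi\to(\psi\to\xi))\to(\varphi\mathbin{\&}\psi\to\xi),\quad (\varphi\mathbin{\&}\psi\to\xi)\to(\varphi\to(\psi\to\xi))$$ and the rules modus ponens (from $\varphi$ and $\varphi\to\psi$ infer $\psi$) and adjunction (from $\varphi$ and $\psi$ infer $\varphi\wedge\psi$). An Abelian $\ell$-group is an Abelian group $(A,+,-,0)$ with a lattice order such that $x\le y$ implies $x+z\le y+z$. An $A$-evaluation is a map $e$ from formulas to $A$ with $e(\varphi\to\psi)=e(\psi)-e(\varphi)$, $e(\varphi\mathbin{\&}\psi)=e(\varphi)+e(\psi)$, $e(\varphi\vee\psi)=e(\varphi)\vee e(\psi)$, $e(\varphi\wedge\psi)=e(\varphi)\wedge e(\psi)$, $e(\mathtt t)=0$. The consecution $\Gamma\rhd\varphi$ is valid in $A$ if every $A$-evaluation $e$ with $e(\psi)\ge 0$ for all $\psi\in\Gamma$ satisfies $e(\varphi)\ge 0$. An $\mathrm{Ab}$-algebra is an Abelian $\ell$-group in which every consecution of $\mathrm{Ab}$ is valid. Theorem. $\mathrm{Ab}$ is a semilinear logic with strong disjunction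 $\vee$. In detail: 1. $\mathrm{Ab}$ is a superabelian logic, i.e. it is a logic that contains $\mathrm{Ab}$ and in which, for all formulas $\varphi,\psi,\xi$ and each $c\in\{\to,\&,\vee,\wedge\}$, both $c(\varphi,\xi)\to c(\psi,\xi)$ and $c(\xi,\varphi)\to c(\xi,\psi)$ are provable from $\{\varphi\to\psi,\ \psi\to\varphi\}$; and the $\mathrm{Ab}$-algebras are exactly all the Abelian $\ell$-groups. 2. (Semilinearity) For every set $\Gamma$ of formulas and every formula $\varphi$: $\Gamma\vdash_{\mathrm{Ab}}\varphi$ if and only if $\Gamma\rhd\varphi$ is valid in every linearly ordered $\mathrm{Ab}$-algebra. 3. (Strong disjunction) For all sets $\Gamma,\Phi,\Psi$ of formulas and every formula $\xi$: if $\Gamma\cup\Phi\vdash_{\mathrm{Ab}}\xi$ and $\Gamma\cup\Psi\vdash_{\mathrm{Ab}}\xi$, then $\Gamma\cup\{\varphi\vee\psi\mid\varphi\in\Phi,\ \psi\in\Psi\}\vdash_{\mathrm{Ab}}\xi$. -/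

import Mathlib

universe u

namespace AbelianLogic

/-- Formulas of the language `{→, &, ∨, ∧, t}` over the countable set of variables
`p₀, p₁, p₂, …`. -/
inductive Fm : Type
  | var : ℕ → Fm
  | imp : Fm → Fm → Fm
  | conj : Fm → Fm → Fm
  | or : Fm → Fm → Fm
  | and : Fm → Fm → Fm
  | t : Fm

infixr:60 " ⟶' " => Fm.imp
infixl:75 " &' " => Fm.conj
infixl:70 " ∨' " => Fm.or
infixl:70 " ∧' " => Fm.and

/-- The endomorphism of the formula algebra that extends `σ : variables → formulas`. -/
def Fm.subst (σ : ℕ → Fm) : Fm → Fm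
  | .var n => σ n
  | .imp φ ψ => .imp (φ.subst σ) (ψ.subst σ)
  | .conj φ ψ => .conj (φ.subst σ) (ψ.subst σ)
  | .or φ ψ => .or (φ.subst σ) (ψ.subst σ)
  | .and φ ψ => .and (φ.subst σ) (ψ.subst σ)
  | .t => .t

/-- A consecution `Γ ▷ φ`; the set of premises may be infinite. -/
@[ext]
structure Consecution : Type where
  premises : Set Fm
  conclusion : Fm

/-- The action of a substitution on a consecution. -/
def Consecution.subst (σ : ℕ → Fm) (c : Consecution) : Consecution :=
  ⟨Fm.subst σ '' c.premises, c.conclusion.subst σ⟩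

/-- Axiomatic systems are the sets of consecutions closed under substitutions. -/
def IsAxiomaticSystem (AS : Set Consecution) : Prop :=
  ∀ (σ : ℕ → Fm), ∀ c ∈ AS, c.subst σ ∈ AS

/-- `φ` has a proof from `Γ` in `AS`: a well-founded tree, with possibly infinite branching,
whose leaves are elements of `Γ` or axioms and whose inner nodes are applications of rules. -/
inductive TreeProvable (AS : Set Consecution) (Γ : Set Fm) : Fm → Prop
  | premise {φ : Fm} : φ ∈ Γ → TreeProvable AS Γ φ
  | rule {c : Consecution} : c ∈ AS → (∀ ψ ∈ c.premises, TreeProvable AS Γ ψ) →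
      TreeProvable AS Γ c.conclusion

/-- The set of all consecutions `Γ ▷ φ` such that `φ` is provable from `Γ` in `AS`. -/
def logicOf (AS : Set Consecution) : Set Consecution :=
  {c | TreeProvable AS c.premises c.conclusion}

/-- A logic is a set of consecutions that is given by some axiomatic system. -/
def IsLogic (L : Set Consecution) : Prop :=
  ∃ AS : Set Consecution, IsAxiomaticSystem AS ∧ L = logicOf AS

/-- `Γ ⊢_L φ`. -/
def Entails (L : Set Consecution) (Γ : Set Fm) (φ : Fm) : Prop :=
  (⟨Γ, φ⟩ : Consecution) ∈ L

/-- The axioms (rules without premises) and rules of Abelian logic. -/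
inductive AbRule : Set Fm → Fm → Prop
  | sf (φ ψ ξ : Fm) : AbRule ∅ ((φ ⟶' ψ) ⟶' ((ψ ⟶' ξ) ⟶' (φ ⟶' ξ)))
  | e (φ ψ ξ : Fm) : AbRule ∅ ((φ ⟶' (ψ ⟶' ξ)) ⟶' (ψ ⟶' (φ ⟶' ξ)))
  | id (φ : Fm) : AbRule ∅ (φ ⟶' φ)
  | abe (φ ψ : Fm) : AbRule ∅ (((φ ⟶' ψ) ⟶' ψ) ⟶' φ)
  | ub₁ (φ ψ : Fm) : AbRule ∅ (φ ⟶' (φ ∨' ψ))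
  | ub₂ (φ ψ : Fm) : AbRule ∅ (ψ ⟶' (φ ∨' ψ))
  | lb₁ (φ ψ : Fm) : AbRule ∅ ((φ ∧' ψ) ⟶' φ)
  | lb₂ (φ ψ : Fm) : AbRule ∅ ((φ ∧' ψ) ⟶' ψ)
  | sup (φ ψ χ : Fm) : AbRule ∅ (((φ ⟶' χ) ∧' (ψ ⟶' χ)) ⟶' ((φ ∨' ψ) ⟶' χ))
  | inf (φ ψ χ : Fm) : AbRule ∅ (((χ ⟶' φ) ∧' (χ ⟶' ψ)) ⟶' (χ ⟶' (φ ∧' ψ)))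
  | push (φ : Fm) : AbRule ∅ (φ ⟶' (Fm.t ⟶' φ))
  | pop (φ : Fm) : AbRule ∅ ((Fm.t ⟶' φ) ⟶' φ)
  | res₁ (φ ψ ξ : Fm) : AbRule ∅ ((φ ⟶' (ψ ⟶' ξ)) ⟶' ((φ &' ψ) ⟶' ξ))
  | res₂ (φ ψ ξ : Fm) : AbRule ∅ (((φ &' ψ) ⟶' ξ) ⟶' (φ ⟶' (ψ ⟶' ξ)))
  | mp (φ ψ : Fm) : AbRule {φ, φ ⟶' ψ} ψ
  | adj (φ ψ : Fm) : AbRule {φ, ψ} (φ ∧' ψ)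

/-- The axiomatic system of Abelian logic. -/
def AbAS : Set Consecution := {c | AbRule c.premises c.conclusion}

/-- Abelian logic `Ab`. -/
def Ab : Set Consecution := logicOf AbAS

/-- The congruence condition: for each connective and each of its argument places, formulas
that provably imply each other can be exchanged (the constant `t` has no argument places). -/
def SCNG (L : Set Consecution) : Prop :=
  ∀ φ ψ ξ : Fm, ∀ c ∈ ({Fm.imp, Fm.conj, Fm.or, Fm.and} : Set (Fm → Fm → Fm)),
    Entails L {φ ⟶' ψ, ψ ⟶' φ} (c φ ξ ⟶' c ψ ξ) ∧
    Entails L {φ ⟶' ψ, ψ ⟶' φ} (c ξ φ ⟶' c ξ ψ)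

/-- Superabelian logics in the language of `Ab`: logics that extend `Ab` and satisfy the
congruence condition. -/
def IsSuperabelian (L : Set Consecution) : Prop :=
  IsLogic L ∧ Ab ⊆ L ∧ SCNG L

/-- Abelian ℓ-groups. -/
structure AbLGroup : Type (u + 1) where
  carrier : Type u
  [addCommGroup : AddCommGroup carrier]
  [lattice : Lattice carrier]
  [isOrderedAddMonoid : IsOrderedAddMonoid carrier]

attribute [instance] AbLGroup.addCommGroup AbLGroup.lattice AbLGroup.isOrderedAddMonoid

/-- `e` is an `A`-evaluation: a homomorphism from the algebra of formulas to the Abelian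
ℓ-group `A`, seen as an algebra with the implication `a → b := b - a`. -/
structure IsEvaluation (A : AbLGroup.{u}) (e : Fm → A.carrier) : Prop where
  imp : ∀ φ ψ, e (φ ⟶' ψ) = e ψ - e φ
  conj : ∀ φ ψ, e (φ &' ψ) = e φ + e ψ
  or : ∀ φ ψ, e (φ ∨' ψ) = e φ ⊔ e ψ
  and : ∀ φ ψ, e (φ ∧' ψ) = e φ ⊓ e ψ
  t : e Fm.t = 0

/-- `Γ ⊨_A φ`. -/
def Valid (A : AbLGroup.{u}) (Γ : Set Fm) (φ : Fm) : Prop :=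
  ∀ e : Fm → A.carrier, IsEvaluation A e → (∀ ψ ∈ Γ, 0 ≤ e ψ) → 0 ≤ e φ

/-- `Γ ⊨_K φ` for a class `K` of Abelian ℓ-groups. -/
def ClassValid (K : Set AbLGroup.{u}) (Γ : Set Fm) (φ : Fm) : Prop :=
  ∀ A ∈ K, Valid A Γ φ

/-- The class of `L`-algebras: the Abelian ℓ-groups in which all consecutions of `L` are
valid. -/
def algebras (L : Set Consecution) : Set AbLGroup.{u} :=
  {A | ∀ c ∈ L, Valid A c.premises c.conclusion}

/-- The class of linearly ordered `L`-algebras. -/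
def linearAlgebras (L : Set Consecution) : Set AbLGroup.{u} :=
  {A | A ∈ algebras L ∧ ∀ a b : A.carrier, a ≤ b ∨ b ≤ a}

/-- Strong `K`-completeness of `L`. -/
def StronglyComplete (L : Set Consecution) (K : Set AbLGroup.{u}) : Prop :=
  ∀ (Γ : Set Fm) (φ : Fm), Entails L Γ φ ↔ ClassValid K Γ φ

/-- Semilinearity: strong completeness with respect to the linearly ordered `L`-algebras. -/
def IsSemilinear (L : Set Consecution) : Prop :=
  StronglyComplete L (linearAlgebras.{u} L)

/-- The set `Φ ∨ Ψ` of all disjunctions `φ ∨ ψ` with `φ ∈ Φ` and `ψ ∈ Ψ`. -/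
def orSet (Φ Ψ : Set Fm) : Set Fm :=
  {χ | ∃ φ ∈ Φ, ∃ ψ ∈ Ψ, χ = φ ∨' ψ}

/-- `∨` is a strong disjunction in `L`. -/
def IsStrongDisjunction (L : Set Consecution) : Prop :=
  ∀ (Γ Φ Ψ : Set Fm) (ξ : Fm),
    Entails L (Γ ∪ Φ) ξ → Entails L (Γ ∪ Ψ) ξ → Entails L (Γ ∪ orSet Φ Ψ) ξ

end AbelianLogic

namespace AbelianLogic

/-! ### Derivations in Abelian logic -/

/-! Everything rests on a sharpened soundness statement. For `a ≥ 0` in an Abelian ℓ-group, the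
positive elements disjoint from `a` are closed under sums and under passing to smaller positive
elements. Hence the formulas whose value has negative part disjoint from `a` contain the axioms and
are closed under modus ponens and adjunction (`IsEvaluation.negPart_inf_eq_zero`). Ordinary
soundness is the case where `a` is the negative part of the conclusion.

The Lindenbaum algebra of a theory is an Abelian ℓ-group, the axiom `abe` supplying inverses.
Sharpened soundness in it yields proof by cases for `φ → ψ` and `ψ → φ`, because `x⁺` and `x⁻` are
disjoint. By Zorn, a theory maximal among those not proving `χ` then has a linearly ordered
Lindenbaum algebra, which gives completeness for chains. On chains the strong disjunction property
is immediate, even for infinite sets. -/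

theorem ab_induction {Γ : Set Fm} {P : Fm → Prop}
    (prem : ∀ φ ∈ Γ, P φ) (ax : ∀ φ, AbRule ∅ φ → P φ)
    (mp : ∀ φ ψ, P φ → P (φ ⟶' ψ) → P ψ) (adj : ∀ φ ψ, P φ → P ψ → P (φ ∧' ψ))
    {φ : Fm} (h : TreeProvable AbAS Γ φ) : P φ := by
  induction h with
  | premise h => exact prem _ h
  | @rule c hc hp ih =>
    clear hp
    obtain ⟨Δ, χ⟩ := c
    change AbRule Δ χ at hc
    change ∀ ψ ∈ Δ, P ψ at ih
    change P χ
    -- Only modus ponens and adjunction have premises; all axiom schemes are left to `ax` together.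
    have key : Δ = ∅ ∨ P χ := by
      cases hc
      case mp φ => exact .inr (mp φ χ (ih _ (by simp)) (ih _ (by simp)))
      case adj φ ψ => exact .inr (adj φ ψ (ih _ (by simp)) (ih _ (by simp)))
      all_goals exact .inl rfl
    rcases key with rfl | h
    · exact ax _ hc
    · exact h

theorem TreeProvable.mono {AS : Set Consecution} {Γ Δ : Set Fm} (h : Γ ⊆ Δ) {φ : Fm}
    (hφ : TreeProvable AS Γ φ) : TreeProvable AS Δ φ := by
  induction hφ with
  | premise h' => exact .premise (h h')
  | rule hc _ ih => exact .rule hc ih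

section Derivations

variable {T : Set Fm} {a b c d : Fm}

theorem TreeProvable.ax (h : AbRule ∅ a) : TreeProvable AbAS T a :=
  .rule (c := ⟨∅, a⟩) h (by simp)

theorem TreeProvable.mp (h₁ : TreeProvable AbAS T (a ⟶' b)) (h₂ : TreeProvable AbAS T a) :
    TreeProvable AbAS T b :=
  .rule (c := ⟨{a, a ⟶' b}, b⟩) (AbRule.mp a b) (by simp [h₁, h₂])

theorem TreeProvable.adj (h₁ : TreeProvable AbAS T a) (h₂ : TreeProvable AbAS T b) :
    TreeProvable AbAS T (a ∧' b) :=
  .rule (c := ⟨{a, b}, a ∧' b⟩) (AbRule.adj a b) (by simp [h₁, h₂])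

/-- `φ` is below `ψ` in the theory `T` if `T` proves `φ → ψ`. -/
def Below (T : Set Fm) (φ ψ : Fm) : Prop := TreeProvable AbAS T (φ ⟶' ψ)

theorem Below.refl (a : Fm) : Below T a a := .ax (.id a)

theorem Below.trans (h₁ : Below T a b) (h₂ : Below T b c) : Below T a c :=
  TreeProvable.mp (.mp (.ax (.sf a b c)) h₁) h₂

theorem below_exchange (h : Below T a (b ⟶' c)) : Below T b (a ⟶' c) :=
  TreeProvable.mp (.ax (.e a b c)) h

theorem below_conj_iff : Below T (a &' b) c ↔ Below T a (b ⟶' c) :=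
  ⟨TreeProvable.mp (.ax (.res₂ a b c)), TreeProvable.mp (.ax (.res₁ a b c))⟩

theorem t_below_iff : Below T Fm.t a ↔ TreeProvable AbAS T a :=
  ⟨TreeProvable.mp (.ax (.pop a)), TreeProvable.mp (.ax (.push a))⟩

theorem Below.imp_left (h : Below T a b) (c : Fm) : Below T (b ⟶' c) (a ⟶' c) :=
  TreeProvable.mp (.ax (.sf a b c)) h

theorem Below.imp_right (h : Below T a b) (c : Fm) : Below T (c ⟶' a) (c ⟶' b) :=
  TreeProvable.mp (below_exchange (.ax (.sf c a b))) h

theorem below_conj_comm : Below T (a &' b) (b &' a) :=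
  below_conj_iff.2 (below_exchange (below_conj_iff.1 (.refl _)))

theorem Below.conj_left (h : Below T a b) (c : Fm) : Below T (a &' c) (b &' c) :=
  below_conj_iff.2 (h.trans (below_conj_iff.1 (.refl _)))

theorem Below.conj (h₁ : Below T a b) (h₂ : Below T c d) : Below T (a &' c) (b &' d) :=
  (h₁.conj_left c).trans (below_conj_comm.trans ((h₂.conj_left b).trans below_conj_comm))

theorem Below.imp (h₁ : Below T b a) (h₂ : Below T c d) : Below T (a ⟶' c) (b ⟶' d) :=
  (h₁.imp_left c).trans (h₂.imp_right b)

theorem below_conj_assoc : Below T (a &' b &' c) (a &' (b &' c)) :=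
  below_conj_iff.2 (below_conj_iff.2
    ((below_conj_iff.1 (.refl _)).trans (.ax (.res₂ b c _))))

theorem conj_assoc_below : Below T (a &' (b &' c)) (a &' b &' c) :=
  below_conj_iff.2
    ((below_conj_iff.1 (below_conj_iff.1 (.refl _))).trans (.ax (.res₁ b c _)))

theorem conj_t_below : Below T (a &' Fm.t) a := below_conj_iff.2 (.ax (.push a))

theorem below_conj_t : Below T a (a &' Fm.t) :=
  (below_conj_iff.1 (.refl _)).trans (.ax (.pop _))

theorem conj_imp_t_below : Below T ((a ⟶' Fm.t) &' a) Fm.t := below_conj_iff.2 (.refl _)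

theorem imp_self_below_t : Below T (a ⟶' a) Fm.t :=
  Below.trans (Below.imp_left (.ax (.pop a)) a) (.ax (.abe Fm.t a))

/-- For `n = (a → t) & a`, `abe` reduces the claim to `t ≤ (n → t) → t`, hence by exchange to `n → t
≤ t → t`. Residuation, exchange and `abe` again give `n → t ≤ a → a ≤ t`. -/
theorem t_below_conj_imp : Below T Fm.t ((a ⟶' Fm.t) &' a) := by
  refine Below.trans (below_exchange (b := Fm.t)
    (a := ((a ⟶' Fm.t) &' a) ⟶' Fm.t) ?_) (.ax (.abe _ Fm.t))
  refine Below.trans ?_ (.ax (.push _))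
  refine Below.trans (.ax (.res₂ _ _ _)) (Below.trans (.ax (.e _ _ _)) ?_)
  exact Below.trans (Below.imp_right (.ax (.abe a Fm.t)) a) imp_self_below_t

theorem below_or_left : Below T a (a ∨' b) := .ax (.ub₁ a b)

theorem below_or_right : Below T b (a ∨' b) := .ax (.ub₂ a b)

theorem and_below_left : Below T (a ∧' b) a := .ax (.lb₁ a b)

theorem and_below_right : Below T (a ∧' b) b := .ax (.lb₂ a b)

theorem or_below (h₁ : Below T a c) (h₂ : Below T b c) : Below T (a ∨' b) c :=
  TreeProvable.mp (.ax (.sup a b c)) (.adj h₁ h₂)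

theorem below_and (h₁ : Below T c a) (h₂ : Below T c b) : Below T c (a ∧' b) :=
  TreeProvable.mp (.ax (.inf a b c)) (.adj h₁ h₂)

end Derivations

/-! ### The Lindenbaum algebra of a theory -/

/-- Provable equivalence in the theory `T`, on a copy of the formulas in the universe `u`. -/
def equivSetoid (T : Set Fm) : Setoid (ULift.{u} Fm) where
  r a b := Below T a.down b.down ∧ Below T b.down a.down
  iseqv := ⟨fun _ => ⟨.refl _, .refl _⟩, fun h => ⟨h.2, h.1⟩,
    fun h₁ h₂ => ⟨h₁.1.trans h₂.1, h₂.2.trans h₁.2⟩⟩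

/-- The carrier of the Lindenbaum algebra of the theory `T`. -/
def Lind (T : Set Fm) : Type u := Quotient (equivSetoid.{u} T)

namespace Lind

variable {T : Set Fm}

/-- The class of a formula. -/
def mk (T : Set Fm) (a : Fm) : Lind.{u} T := Quotient.mk (equivSetoid.{u} T) ⟨a⟩

theorem ind {P : Lind.{u} T → Prop} (h : ∀ a, P (mk T a)) (x : Lind.{u} T) : P x :=
  Quotient.ind (fun a => h a.down) x

theorem mk_eq {a b : Fm} (h₁ : Below T a b) (h₂ : Below T b a) : mk.{u} T a = mk T b :=
  Quotient.sound ⟨h₁, h₂⟩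

/-- A binary operation that respects provable equivalence, on the Lindenbaum algebra. -/
def lift₂ (f : Fm → Fm → Fm)
    (h : ∀ a a' b b', Below T a a' → Below T a' a → Below T b b' → Below T b' b →
      Below T (f a b) (f a' b')) : Lind.{u} T → Lind.{u} T → Lind.{u} T :=
  Quotient.map₂ (fun a b => ⟨f a.down b.down⟩) fun _ _ ha _ _ hb =>
    ⟨h _ _ _ _ ha.1 ha.2 hb.1 hb.2, h _ _ _ _ ha.2 ha.1 hb.2 hb.1⟩

instance : PartialOrder (Lind.{u} T) where
  le := Quotient.lift₂ (fun a b => Below T a.down b.down) fun _ _ _ _ ha hb =>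
    propext ⟨fun h => ha.2.trans (h.trans hb.1), fun h => ha.1.trans (h.trans hb.2)⟩
  le_refl := ind fun a => Below.refl a
  le_trans := ind fun _ => ind fun _ => ind fun _ => Below.trans
  le_antisymm := ind fun _ => ind fun _ => mk_eq

instance : Lattice (Lind.{u} T) where
  sup := lift₂ Fm.or fun _ _ _ _ h₁ _ h₂ _ =>
    or_below (h₁.trans below_or_left) (h₂.trans below_or_right)
  inf := lift₂ Fm.and fun _ _ _ _ h₁ _ h₂ _ =>
    below_and (and_below_left.trans h₁) (and_below_right.trans h₂)
  le_sup_left := ind fun _ => ind fun _ => below_or_left (T := T)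
  le_sup_right := ind fun _ => ind fun _ => below_or_right (T := T)
  sup_le := ind fun _ => ind fun _ => ind fun _ => or_below (T := T)
  inf_le_left := ind fun _ => ind fun _ => and_below_left (T := T)
  inf_le_right := ind fun _ => ind fun _ => and_below_right (T := T)
  le_inf := ind fun _ => ind fun _ => ind fun _ => below_and (T := T)

instance : Add (Lind.{u} T) := ⟨lift₂ Fm.conj fun _ _ _ _ h₁ _ h₂ _ => h₁.conj h₂⟩

instance : Zero (Lind.{u} T) := ⟨mk T Fm.t⟩

instance : Neg (Lind.{u} T) :=
  ⟨fun x => lift₂ Fm.imp (fun _ _ _ _ _ h₁ h₂ _ => h₁.imp h₂) x 0⟩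

theorem add_comm' (x y : Lind.{u} T) : x + y = y + x := by
  induction x using ind; induction y using ind
  exact mk_eq below_conj_comm below_conj_comm

theorem add_zero' (x : Lind.{u} T) : x + 0 = x := by
  induction x using ind
  exact mk_eq conj_t_below below_conj_t

instance : AddCommGroup (Lind.{u} T) where
  add_assoc := ind fun _ => ind fun _ => ind fun _ => mk_eq below_conj_assoc conj_assoc_below
  add_comm := add_comm'
  add_zero := add_zero'
  zero_add x := (add_comm' 0 x).trans (add_zero' x)
  neg_add_cancel := ind fun _ => mk_eq conj_imp_t_below t_below_conj_imp
  nsmul := nsmulRec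
  zsmul := zsmulRec

instance : IsOrderedAddMonoid (Lind.{u} T) where
  add_le_add_left := ind fun _ => ind fun _ h => ind fun c => Below.conj_left (T := T) h c

/-- The Lindenbaum algebra of the theory `T`, as an Abelian ℓ-group. -/
def algebra (T : Set Fm) : AbLGroup.{u} := ⟨Lind.{u} T⟩

/-- Both sides are the greatest `z` with `z + mk T a ≤ mk T b`. -/
theorem mk_imp (a b : Fm) : mk.{u} T (a ⟶' b) = mk T b - mk T a := by
  have key : ∀ c : Fm, mk.{u} T c ≤ mk T (a ⟶' b) ↔ mk.{u} T c + mk T a ≤ mk T b :=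
    fun _ => below_conj_iff.symm
  apply le_antisymm
  · exact le_sub_iff_add_le.2 ((key _).1 le_rfl)
  · induction h : mk.{u} T b - mk T a using ind with
    | h c => rw [key, ← h, sub_add_cancel]

theorem isEvaluation_mk (T : Set Fm) : IsEvaluation (algebra.{u} T) (mk T) where
  imp := mk_imp
  conj _ _ := rfl
  or _ _ := rfl
  and _ _ := rfl
  t := rfl

theorem zero_le_mk_iff {a : Fm} : 0 ≤ mk.{u} T a ↔ TreeProvable AbAS T a := t_below_iff

end Lind

/-! ### Soundness -/

section LatticeGroup

variable {G : Type*} [AddCommGroup G] [Lattice G] [IsOrderedAddMonoid G]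

/-- As `c ≥ 0`, `(b + c) ⊓ a ≤ (b ⊓ a) + c = c`, so the left side lies below `c ⊓ a = 0`. -/
theorem inf_add_eq_zero {a b c : G} (hb : 0 ≤ b) (hc : 0 ≤ c)
    (h₁ : b ⊓ a = 0) (h₂ : c ⊓ a = 0) : (b + c) ⊓ a = 0 := by
  have ha : 0 ≤ a := h₁ ▸ inf_le_right
  refine le_antisymm ?_ (le_inf (add_nonneg hb hc) ha)
  have h : (b + c) ⊓ a ≤ b ⊓ a + c := by
    rw [inf_add]
    exact le_inf inf_le_left (inf_le_right.trans (le_add_of_nonneg_right hc))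
  rw [h₁, zero_add] at h
  exact (le_inf h inf_le_right).trans h₂.le

theorem negPart_inf_eq_zero_of_le {a x y z : G} (hz : z⁻ ≤ x⁻ + y⁻)
    (h₁ : x⁻ ⊓ a = 0) (h₂ : y⁻ ⊓ a = 0) : z⁻ ⊓ a = 0 := by
  have ha : 0 ≤ a := h₁ ▸ inf_le_right
  refine le_antisymm ?_ (le_inf (negPart_nonneg z) ha)
  exact (inf_le_inf_right a hz).trans
    (inf_add_eq_zero (negPart_nonneg x) (negPart_nonneg y) h₁ h₂).le

end LatticeGroup

theorem IsEvaluation.nonneg_of_axiom {A : AbLGroup.{u}} {e : Fm → A.carrier}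
    (he : IsEvaluation A e) {φ : Fm} (h : AbRule ∅ φ) : 0 ≤ e φ := by
  -- A variable premise set permits case analysis; the two proper rules drop out because their
  -- premise sets are nonempty.
  have key : ∀ Δ, AbRule Δ φ → Δ = ∅ → 0 ≤ e φ := by
    intro Δ h hΔ
    cases h
    case mp => exact absurd hΔ (Set.insert_nonempty _ _).ne_empty
    case adj => exact absurd hΔ (Set.insert_nonempty _ _).ne_empty
    case sup φ ψ χ =>
      simp only [he.imp, he.and, he.or]
      rw [sub_nonneg, le_sub_comm]
      refine sup_le ?_ ?_ <;> rw [le_sub_comm]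
      exacts [inf_le_left, inf_le_right]
    case inf φ ψ χ =>
      simp only [he.imp, he.and]
      rw [sub_nonneg, le_sub_iff_add_le]
      refine le_inf ?_ ?_ <;> rw [← le_sub_iff_add_le]
      exacts [inf_le_left, inf_le_right]
    case ub₁ => simp [he.imp, he.or]
    case ub₂ => simp [he.imp, he.or]
    case lb₁ => simp [he.imp, he.and]
    case lb₂ => simp [he.imp, he.and]
    all_goals
      simp only [he.imp, he.conj, he.t]
      apply le_of_eq
      abel
  exact key ∅ h rfl

/-- Formulas whose negative part is orthogonal to a given element are closed under
provability. -/
theorem IsEvaluation.negPart_inf_eq_zero {A : AbLGroup.{u}} {e : Fm → A.carrier}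
    (he : IsEvaluation A e) {a : A.carrier} (ha : 0 ≤ a) {Γ : Set Fm}
    (hΓ : ∀ ψ ∈ Γ, (e ψ)⁻ ⊓ a = 0) {φ : Fm} (h : TreeProvable AbAS Γ φ) :
    (e φ)⁻ ⊓ a = 0 := by
  refine ab_induction (P := fun φ => (e φ)⁻ ⊓ a = 0) hΓ ?_ ?_ ?_ h
  · intro φ h
    rw [negPart_eq_zero.2 (he.nonneg_of_axiom h), inf_eq_left.2 ha]
  · intro φ ψ h₁ h₂
    -- Here `-e ψ = -e φ + -(e ψ - e φ)`, so the negative part of the conclusion is at most the sum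
    -- of those of the premises.
    refine negPart_inf_eq_zero_of_le ?_ h₁ h₂
    rw [he.imp, negPart_def]
    refine sup_le ?_ (add_nonneg (negPart_nonneg _) (negPart_nonneg _))
    refine le_trans (le_of_eq ?_) (add_le_add (neg_le_negPart (e φ)) (neg_le_negPart _))
    abel
  · intro φ ψ h₁ h₂
    refine negPart_inf_eq_zero_of_le ?_ h₁ h₂
    rw [he.and, negPart_def, neg_inf]
    refine sup_le (sup_le ?_ ?_) (add_nonneg (negPart_nonneg _) (negPart_nonneg _))
    · exact (neg_le_negPart _).trans (le_add_of_nonneg_right (negPart_nonneg _))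
    · exact (neg_le_negPart _).trans (le_add_of_nonneg_left (negPart_nonneg _))

theorem valid_of_treeProvable (A : AbLGroup.{u}) {Γ : Set Fm} {φ : Fm}
    (h : TreeProvable AbAS Γ φ) : Valid A Γ φ := by
  intro e he hΓ
  -- The negative part of `e φ` turns out disjoint from itself, hence zero.
  have := he.negPart_inf_eq_zero (negPart_nonneg (e φ)) (fun ψ hψ => by
    rw [negPart_eq_zero.2 (hΓ ψ hψ), inf_eq_left.2 (negPart_nonneg _)]) h
  rwa [inf_idem, negPart_eq_zero] at this

theorem algebras_ab : algebras.{u} Ab = Set.univ :=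
  Set.eq_univ_of_forall fun A _ hc => valid_of_treeProvable A hc

/-! ### `Ab` is superabelian -/

theorem isAxiomaticSystem_abAS : IsAxiomaticSystem AbAS := by
  rintro σ ⟨Γ, φ⟩ h
  change AbRule Γ φ at h
  change AbRule (Fm.subst σ '' Γ) (φ.subst σ)
  cases h <;> simp only [Set.image_empty, Set.image_pair, Fm.subst] <;> constructor

/-- In the Lindenbaum algebra of the two premises the classes of `φ` and `ψ` coincide, and the
operations act on classes. -/
theorem scng_ab : SCNG Ab := by
  intro φ ψ ξ c hc
  set T : Set Fm := {φ ⟶' ψ, ψ ⟶' φ} with hT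
  have he := Lind.isEvaluation_mk.{0} T
  have heq : Lind.mk.{0} T φ = Lind.mk T ψ :=
    Lind.mk_eq (.premise (by simp [hT])) (.premise (by simp [hT]))
  change TreeProvable AbAS T _ ∧ TreeProvable AbAS T _
  rw [← Lind.zero_le_mk_iff.{0}, ← Lind.zero_le_mk_iff.{0}, Lind.mk_imp, Lind.mk_imp]
  have key : Lind.mk.{0} T (c φ ξ) = Lind.mk T (c ψ ξ) ∧
      Lind.mk.{0} T (c ξ φ) = Lind.mk T (c ξ ψ) := by
    rcases hc with rfl | rfl | rfl | rfl
    · rw [he.imp, he.imp, he.imp, he.imp, heq]; exact ⟨rfl, rfl⟩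
    · rw [he.conj, he.conj, he.conj, he.conj, heq]; exact ⟨rfl, rfl⟩
    · rw [he.or, he.or, he.or, he.or, heq]; exact ⟨rfl, rfl⟩
    · rw [he.and, he.and, he.and, he.and, heq]; exact ⟨rfl, rfl⟩
  rw [key.1, key.2, sub_self, sub_self]
  exact ⟨le_rfl, le_rfl⟩

theorem isSuperabelian_ab : IsSuperabelian Ab :=
  ⟨⟨AbAS, isAxiomaticSystem_abAS, rfl⟩, subset_rfl, scng_ab⟩

/-! ### Linear completeness -/

/-- Proof by cases for `φ → ψ` and `ψ → φ`. -/
theorem treeProvable_of_insert_imp {T : Set Fm} {φ ψ χ : Fm}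
    (h₁ : TreeProvable AbAS (insert (φ ⟶' ψ) T) χ)
    (h₂ : TreeProvable AbAS (insert (ψ ⟶' φ) T) χ) : TreeProvable AbAS T χ := by
  have he := Lind.isEvaluation_mk.{0} T
  let x : Lind.{0} T := Lind.mk T (φ ⟶' ψ)
  have hx : Lind.mk.{0} T (ψ ⟶' φ) = -x := by simp only [x, Lind.mk_imp, neg_sub]
  have hT : ∀ ζ ∈ T, (Lind.mk.{0} T ζ)⁻ = 0 := fun ζ hζ =>
    negPart_eq_zero.2 (Lind.zero_le_mk_iff.2 (.premise hζ))
  -- The premise `φ → ψ` has negative part `x⁻`, disjoint from `x⁺`.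
  have k₁ : (Lind.mk.{0} T χ)⁻ ⊓ x⁺ = 0 := by
    refine he.negPart_inf_eq_zero (posPart_nonneg x) ?_ h₁
    rintro ζ (rfl | hζ)
    · exact (inf_comm _ _).trans (posPart_inf_negPart_eq_zero x)
    · exact (congrArg (· ⊓ x⁺) (hT ζ hζ)).trans (inf_eq_left.2 (posPart_nonneg x))
  -- The premise `ψ → φ` has negative part `x⁺`, which `k₁` makes disjoint from the negative part of
  -- `χ`; the latter is then disjoint from itself.
  have k₂ : (Lind.mk.{0} T χ)⁻ ⊓ (Lind.mk.{0} T χ)⁻ = 0 := by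
    refine he.negPart_inf_eq_zero (negPart_nonneg (Lind.mk.{0} T χ)) ?_ h₂
    rintro ζ (rfl | hζ)
    · rw [hx]
      refine Eq.trans (congrArg (· ⊓ (Lind.mk.{0} T χ)⁻) (negPart_neg x)) ?_
      exact (inf_comm _ _).trans k₁
    · exact (congrArg (· ⊓ (Lind.mk.{0} T χ)⁻) (hT ζ hζ)).trans
        (inf_eq_left.2 (negPart_nonneg _))
  rwa [inf_idem, negPart_eq_zero, Lind.zero_le_mk_iff] at k₂

/-- Each rule has at most two premises, and two members of a chain lie in the larger one. Axioms
need some member of `C`, hence `hne`. -/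
theorem exists_treeProvable_of_sUnion {C : Set (Set Fm)} (hC : IsChain (· ⊆ ·) C)
    (hne : C.Nonempty) {φ : Fm} (h : TreeProvable AbAS (⋃₀ C) φ) :
    ∃ T ∈ C, TreeProvable AbAS T φ := by
  have join : ∀ φ ψ, (∃ T ∈ C, TreeProvable AbAS T φ) → (∃ T ∈ C, TreeProvable AbAS T ψ) →
      ∃ T ∈ C, TreeProvable AbAS T φ ∧ TreeProvable AbAS T ψ := by
    rintro φ ψ ⟨S, hS, h₁⟩ ⟨T, hT, h₂⟩
    rcases hC.total hS hT with h | h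
    · exact ⟨T, hT, h₁.mono h, h₂⟩
    · exact ⟨S, hS, h₁, h₂.mono h⟩
  refine ab_induction (P := fun φ => ∃ T ∈ C, TreeProvable AbAS T φ) ?_ ?_ ?_ ?_ h
  · rintro φ ⟨T, hT, hφ⟩
    exact ⟨T, hT, .premise hφ⟩
  · exact fun φ h => hne.imp fun T hT => ⟨hT, .ax h⟩
  · intro φ ψ h₁ h₂
    obtain ⟨T, hT, h₁, h₂⟩ := join _ _ h₁ h₂
    exact ⟨T, hT, h₂.mp h₁⟩
  · intro φ ψ h₁ h₂
    obtain ⟨T, hT, h₁, h₂⟩ := join _ _ h₁ h₂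
    exact ⟨T, hT, h₁.adj h₂⟩

theorem exists_linear_theory {Γ : Set Fm} {χ : Fm} (h : ¬ TreeProvable AbAS Γ χ) :
    ∃ T, Γ ⊆ T ∧ ¬ TreeProvable AbAS T χ ∧ ∀ φ ψ, Below T φ ψ ∨ Below T ψ φ := by
  obtain ⟨T, hΓT, hT⟩ := zorn_subset_nonempty {T | ¬ TreeProvable AbAS T χ}
    (fun C hCS hC hne => ⟨⋃₀ C, fun hp => by
      obtain ⟨T, hTC, hTχ⟩ := exists_treeProvable_of_sUnion hC hne hp
      exact hCS hTC hTχ, fun _ => Set.subset_sUnion_of_mem⟩) Γ h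
  have hmem : ∀ ζ, ¬ TreeProvable AbAS T ζ → TreeProvable AbAS (insert ζ T) χ := by
    intro ζ hζ
    by_contra hcon
    -- If adding `ζ` still did not prove `χ`, maximality would put `ζ` into `T`.
    exact hζ (.premise (hT.le_of_ge hcon (Set.subset_insert ζ T) (Set.mem_insert ζ T)))
  refine ⟨T, hΓT, hT.prop, fun φ ψ => ?_⟩
  by_contra! hcon
  exact hT.prop (treeProvable_of_insert_imp (hmem _ hcon.1) (hmem _ hcon.2))

theorem isSemilinear_ab : IsSemilinear.{u} Ab := by
  intro Γ χ
  refine ⟨fun h A _ => valid_of_treeProvable A h, fun h => ?_⟩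
  by_contra hcon
  obtain ⟨T, hΓT, hT, hlin⟩ := exists_linear_theory hcon
  -- The countermodel is the Lindenbaum algebra of `T`, a chain by `hlin`.
  refine hT (Lind.zero_le_mk_iff.{u}.1 (h (Lind.algebra T) ⟨?_, ?_⟩ (Lind.mk T)
    (Lind.isEvaluation_mk T) fun ψ hψ => Lind.zero_le_mk_iff.2 (.premise (hΓT hψ))))
  · rw [algebras_ab]
    trivial
  · exact Lind.ind fun a => Lind.ind fun b => hlin a b

theorem isStrongDisjunction_ab : IsStrongDisjunction Ab := by
  intro Γ Φ Ψ ξ h₁ h₂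
  rw [isSemilinear_ab.{0}] at h₁ h₂ ⊢
  intro A hA e he hΓ
  by_cases hΦ : ∀ φ ∈ Φ, 0 ≤ e φ
  · exact h₁ A hA e he fun ψ hψ => hψ.elim (fun h => hΓ ψ (.inl h)) (hΦ ψ)
  · push Not at hΦ
    obtain ⟨φ, hφ, hneg⟩ := hΦ
    -- A single `φ ∈ Φ` with a negative value forces every `ψ ∈ Ψ` to be nonnegative, since on a
    -- chain `e φ ⊔ e ψ` is one of the two values.
    refine h₂ A hA e he fun ψ hψ => hψ.elim (fun h => hΓ ψ (.inl h)) fun h => ?_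
    have hor := hΓ (φ ∨' ψ) (.inr ⟨φ, hφ, ψ, h, rfl⟩)
    rw [he.or] at hor
    rcases hA.2 (e φ) (e ψ) with hle | hle
    · rwa [sup_eq_right.2 hle] at hor
    · rw [sup_eq_left.2 hle] at hor
      exact absurd hor hneg

end AbelianLogic

theorem theoremt :
    AbelianLogic.IsSuperabelian AbelianLogic.Ab ∧
    AbelianLogic.algebras.{u} AbelianLogic.Ab = Set.univ ∧
    AbelianLogic.IsSemilinear.{u} AbelianLogic.Ab ∧
    AbelianLogic.IsStrongDisjunction AbelianLogic.Ab :=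
  ⟨AbelianLogic.isSuperabelian_ab, AbelianLogic.algebras_ab, AbelianLogic.isSemilinear_ab,
    AbelianLogic.isStrongDisjunction_ab⟩
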